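/- Let $(F,g_F)$ be a compact connected smooth Riemannian manifold without boundary, let $f\colon F\to(0,\infty)$ be smooth, let $I=(t_1,t_2)$ with $-\infty\le t_1<t_2\le\infty$, and let $M=I_f\times F$ be the standard static space-time, i.e. the product manifold $I\times F$ furnished with the Lorentzian metric $g=-f^2\,\mathrm dt^2\oplus g_F$. Then $(M,g)$ satisfies the strong energy condition ($\mathrm{Ric}(x,x)\ge 0$ for all causal tangent vectors $x$, i.e. all nonzero $x$ with $g(x,x)\le 0$) if and only if it satisfies the timelike convergence condition ($\mathrm{Ric}(x,x)\ge 0$ for all timelike tangent vectors $x$, i.e. all $x$ with $g(x,x)<0$); and if $(M,g)$ satisfies these equivalent conditions, then $f$ is a positive constant. Here $\mathrm{Ric}$ is the Ricci tensor of $g$, with the sign convention for which round spheres have positive Ricci curvature. -/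

import Mathlib

open scoped Manifold ContDiff Topology Bundle

noncomputable section

namespace StaticSpacetime

section Coordinates

variable {V : Type*} [NormedAddCommGroup V] [NormedSpace ℝ V]
  {ι : Type*} [Fintype ι] [DecidableEq ι]

/-- Christoffel symbols `Γ^k_{ij}` at the point `y` of a metric with components `G y i j` in the
linear coordinates of `V` given by the basis `b`:
`Γ^k_{ij} = (1/2) ∑_l g^{kl} (∂_i g_{jl} + ∂_j g_{il} - ∂_l g_{ij})`. -/
def christoffel (b : Module.Basis ι ℝ V) (G : V → Matrix ι ι ℝ) (k i j : ι) (y : V) : ℝ :=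
  (1 / 2) * ∑ l, (G y)⁻¹ k l *
    (fderiv ℝ (fun z => G z j l) y (b i) + fderiv ℝ (fun z => G z i l) y (b j)
      - fderiv ℝ (fun z => G z i j) y (b l))

/-- Components of the Ricci tensor (with the sign for which round spheres have positive Ricci
curvature):
`R_{jk} = ∑_i (∂_i Γ^i_{jk} - ∂_j Γ^i_{ik}) + ∑_{i,l} (Γ^i_{il} Γ^l_{jk} - Γ^i_{jl} Γ^l_{ik})`. -/
def ricciCoord (b : Module.Basis ι ℝ V) (G : V → Matrix ι ι ℝ) (y : V) (j k : ι) : ℝ :=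
  ∑ i, (fderiv ℝ (christoffel b G i j k) y (b i) - fderiv ℝ (christoffel b G i i k) y (b j))
    + ∑ i, ∑ l, (christoffel b G i i l y * christoffel b G l j k y
      - christoffel b G i j l y * christoffel b G l i k y)

end Coordinates

section Manifold

variable {E : Type*} [NormedAddCommGroup E] [NormedSpace ℝ E]
  {ι : Type*} [Fintype ι] [DecidableEq ι] (b : Module.Basis ι ℝ E)
  {H : Type*} [TopologicalSpace H] (I : ModelWithCorners ℝ E H)
  {M : Type*} [TopologicalSpace M] [ChartedSpace H M]

/-- The components `g_{ij} = g(∂_i, ∂_j)` of the tensor field `g` in the chart `e`, as functions of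
the coordinates; `∂_i` is the image of the basis vector `b i` under the derivative of the inverse
chart. -/
def metricInChart (g : ∀ p : M, TangentSpace I p →L[ℝ] TangentSpace I p →L[ℝ] ℝ)
    (e : OpenPartialHomeomorph M H) (y : E) : Matrix ι ι ℝ := fun i j =>
  g ((e.extend I).symm y) (mfderiv 𝓘(ℝ, E) I (e.extend I).symm y (b i))
    (mfderiv 𝓘(ℝ, E) I (e.extend I).symm y (b j))

/-- The value `Ric(v, w) = ∑_{j,k} R_{jk} v^j w^k` at the point `p` of the Ricci tensor of `g`,
computed in the coordinates of the chart `e` around `p`. By tensoriality, the value does not depend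
on the smooth chart (nor on the basis `b` of the model space). -/
def ricci (g : ∀ p : M, TangentSpace I p →L[ℝ] TangentSpace I p →L[ℝ] ℝ)
    (e : OpenPartialHomeomorph M H) (p : M) (v w : TangentSpace I p) : ℝ :=
  ∑ j, ∑ k, ricciCoord b (metricInChart b I g e) (e.extend I p) j k
    * b.repr (mfderiv I 𝓘(ℝ, E) (e.extend I) p v) j
    * b.repr (mfderiv I 𝓘(ℝ, E) (e.extend I) p w) k

/-- Timelike tangent vectors. -/
def IsTimelike (g : ∀ p : M, TangentSpace I p →L[ℝ] TangentSpace I p →L[ℝ] ℝ)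
    (p : M) (v : TangentSpace I p) : Prop :=
  g p v v < 0

/-- Causal (nonzero, timelike or null) tangent vectors. -/
def IsCausal (g : ∀ p : M, TangentSpace I p →L[ℝ] TangentSpace I p →L[ℝ] ℝ)
    (p : M) (v : TangentSpace I p) : Prop :=
  v ≠ 0 ∧ g p v v ≤ 0

/-- Strong energy condition: `Ric(v, v) ≥ 0` for all causal tangent vectors `v`, where the Ricci
tensor may be computed in any smooth chart around the base point. -/
def StrongEnergyCondition
    (g : ∀ p : M, TangentSpace I p →L[ℝ] TangentSpace I p →L[ℝ] ℝ) : Prop :=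
  ∀ (p : M) (v : TangentSpace I p), IsCausal I g p v →
    ∀ e ∈ IsManifold.maximalAtlas I ∞ M, p ∈ e.source → 0 ≤ ricci b I g e p v v

/-- Timelike convergence condition: `Ric(v, v) ≥ 0` for all timelike tangent vectors `v`. -/
def TimelikeConvergenceCondition
    (g : ∀ p : M, TangentSpace I p →L[ℝ] TangentSpace I p →L[ℝ] ℝ) : Prop :=
  ∀ (p : M) (v : TangentSpace I p), IsTimelike I g p v →
    ∀ e ∈ IsManifold.maximalAtlas I ∞ M, p ∈ e.source → 0 ≤ ricci b I g e p v v

end Manifold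

/-- The open interval `(t₁, t₂)` of real numbers, with possibly infinite end points, as an open
submanifold of `ℝ`. -/
def openInterval (t₁ t₂ : EReal) : TopologicalSpace.Opens ℝ :=
  ⟨{t | t₁ < (t : EReal) ∧ (t : EReal) < t₂},
    (isOpen_lt continuous_const continuous_coe_real_ereal).inter
      (isOpen_lt continuous_coe_real_ereal continuous_const)⟩

/-- The basis `∂_t, ∂_1, …, ∂_s` of the model space `ℝ × ℝ^s` of the product `(t₁, t₂) × F`. -/
def staticBasis (s : ℕ) : Module.Basis (Unit ⊕ Fin s) ℝ (ℝ × EuclideanSpace ℝ (Fin s)) :=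
  (Module.Basis.singleton Unit ℝ).prod (EuclideanSpace.basisFun (Fin s) ℝ).toBasis

/-- The metric `-f² dt² ⊕ g_F`, i.e. `σ^* g_F - (f ∘ σ)² dt ⊗ dt`, on the product `(t₁, t₂) × F`. -/
def staticMetric {s : ℕ} {F : Type*} [TopologicalSpace F]
    [ChartedSpace (EuclideanSpace ℝ (Fin s)) F] [IsManifold (𝓡 s) ∞ F]
    (t₁ t₂ : EReal) (f : F → ℝ)
    (gF : Bundle.ContMDiffRiemannianMetric (𝓡 s) ∞ (EuclideanSpace ℝ (Fin s))
      (fun x : F => TangentSpace (𝓡 s) x))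
    (p : openInterval t₁ t₂ × F) :
    TangentSpace (𝓘(ℝ, ℝ).prod (𝓡 s)) p →L[ℝ] TangentSpace (𝓘(ℝ, ℝ).prod (𝓡 s)) p →L[ℝ] ℝ :=
  let dt : TangentSpace (𝓘(ℝ, ℝ).prod (𝓡 s)) p →L[ℝ] ℝ :=
    mfderiv (𝓘(ℝ, ℝ).prod (𝓡 s)) 𝓘(ℝ, ℝ)
      (fun q : openInterval t₁ t₂ × F => ((q.1 : openInterval t₁ t₂) : ℝ)) p
  let dσ : TangentSpace (𝓘(ℝ, ℝ).prod (𝓡 s)) p →L[ℝ] TangentSpace (𝓡 s) p.2 :=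
    mfderiv (𝓘(ℝ, ℝ).prod (𝓡 s)) (𝓡 s) (Prod.snd : openInterval t₁ t₂ × F → F) p
  (ContinuousLinearMap.precomp ℝ dσ) ∘L (gF.inner p.2) ∘L dσ - (f p.2 ^ 2) • dt.smulRight dt

end StaticSpacetime

end

open scoped Manifold ContDiff Topology Bundle

noncomputable section

namespace StaticSpacetime

/-! ### Second-order conditions at maxima and the touching lemma. -/

section MaximumPrinciple

variable {V : Type*} [NormedAddCommGroup V] [NormedSpace ℝ V]

/-! Causal vectors are limits of timelike ones: adding a small multiple of `∂_t` or `-∂_t` to a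
causal vector makes it timelike. At a fixed point `Ric(v, v)` is continuous in `v`, so the timelike
condition passes to the limit; the other direction is immediate, since timelike vectors are nonzero.

For rigidity only `v = ∂_t` is needed. A computation with Christoffel symbols gives `Ric(∂_t, ∂_t) =
f Δf`, with `Δ` the Laplacian of `g_F`. In a chart this is an elliptic operator without zeroth-order
term applied to `f` (`exists_ricciCoord_eq_ellipticOp`), so the condition makes `f` a subsolution.
On the compact `F` it attains its maximum; Hopf's strong maximum principle
(`eventually_eq_of_ellipticOp_nonneg`) makes the set of maximum points open. It is also closed and
nonempty, hence all of the connected `F`. -/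

theorem fderiv_fderiv_apply {f : V → ℝ} {x : V} (hf : ContDiffAt ℝ 2 f x) (v w : V) :
    fderiv ℝ (fun z => fderiv ℝ f z w) x v = fderiv ℝ (fderiv ℝ f) x v w := by
  have h : DifferentiableAt ℝ (fderiv ℝ f) x :=
    (hf.fderiv_right (m := 1) (by norm_num)).differentiableAt (by norm_num)
  have := (h.hasFDerivAt.clm_apply (hasFDerivAt_const w x)).fderiv
  rw [this]; simp

/-- On the line through `x` along `v`, a positive second derivative at the critical point would give
a local minimum as well. The restriction would then be locally constant, with zero second
derivative. -/
theorem _root_.IsLocalMax.fderiv_fderiv_nonpos {f : V → ℝ} {x : V} (hf : ContDiffAt ℝ 2 f x)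
    (hx : IsLocalMax f x) (v : V) : fderiv ℝ (fderiv ℝ f) x v v ≤ 0 := by
  by_contra! hpos
  set γ : ℝ → V := fun t => x + t • v with hγ
  have hγc : Continuous γ := by fun_prop
  have hγ0 : γ 0 = x := by simp [hγ]
  have hγt : Filter.Tendsto γ (𝓝 0) (𝓝 x) := by simpa [hγ0] using hγc.tendsto 0
  have hγd (t : ℝ) : HasDerivAt γ v t := by
    simpa [hγ] using ((hasDerivAt_id t).smul_const v).const_add x
  have hev : ∀ᶠ t in 𝓝 (0 : ℝ), deriv (f ∘ γ) t = fderiv ℝ f (γ t) v := by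
    have h1 : ∀ᶠ y in 𝓝 x, DifferentiableAt ℝ f y :=
      (hf.eventually (by simp)).mono fun y hy => hy.differentiableAt (by norm_num)
    filter_upwards [hγt.eventually h1] with t ht
    exact (ht.hasFDerivAt.comp_hasDerivAt t (hγd t)).deriv
  have h2 : deriv (deriv (f ∘ γ)) 0 = fderiv ℝ (fderiv ℝ f) x v v := by
    rw [Filter.EventuallyEq.deriv_eq hev]
    have h : DifferentiableAt ℝ (fderiv ℝ f) (γ 0) := by
      rw [hγ0]
      exact (hf.fderiv_right (m := 1) (by norm_num)).differentiableAt (by norm_num)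
    have h3 := (h.hasFDerivAt.comp_hasDerivAt 0 (hγd 0)).clm_apply (hasDerivAt_const (0 : ℝ) v)
    simpa [hγ0] using h3.deriv
  have hmax : IsLocalMax (f ∘ γ) 0 := by
    have : ∀ᶠ t in 𝓝 (0 : ℝ), f (γ t) ≤ f x := hγt.eventually hx
    filter_upwards [this] with t ht
    simpa [hγ0] using ht
  have hcont : ContinuousAt (f ∘ γ) 0 :=
    ContinuousAt.comp (by rw [hγ0]; exact hf.continuousAt) hγc.continuousAt
  have hmin : IsLocalMin (f ∘ γ) 0 :=
    isLocalMin_of_deriv_deriv_pos (h2 ▸ hpos) hmax.deriv_eq_zero hcont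
  have hconst : f ∘ γ =ᶠ[𝓝 0] fun _ => (f ∘ γ) 0 := by
    filter_upwards [hmax, hmin] with t h1 h2
    exact le_antisymm h1 h2
  have h0 : deriv (deriv (f ∘ γ)) 0 = 0 := by
    rw [hconst.deriv.deriv_eq]; simp
  rw [h2] at h0
  exact hpos.ne' h0

variable {ι : Type*} [Fintype ι] (b : Module.Basis ι ℝ V)

/-- The second order differential operator `∑ A_{il} ∂_i ∂_l f + ∑ c_l ∂_l f`, where the partial
derivatives are taken along the basis `b`. -/
def ellipticOp (A : V → Matrix ι ι ℝ) (c : V → ι → ℝ) (f : V → ℝ) (x : V) : ℝ :=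
  ∑ i, ∑ l, A x i l * fderiv ℝ (fun z => fderiv ℝ f z (b l)) x (b i)
    + ∑ l, c x l * fderiv ℝ f x (b l)

variable {b} {A : V → Matrix ι ι ℝ} {c : V → ι → ℝ}

open scoped MatrixOrder Matrix.Norms.L2Operator in
-- The gradient vanishes at the maximum. Factoring `A x = Bᴴ B` turns the second-order part into a
-- sum of second derivatives of `f` along the rows of `B`, each nonpositive.
theorem ellipticOp_nonpos_of_isLocalMax {f : V → ℝ} {x : V} (hA : (A x).PosSemidef)
    (hf : ContDiffAt ℝ 2 f x) (hx : IsLocalMax f x) : ellipticOp b A c f x ≤ 0 := by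
  classical
  obtain ⟨B, hB⟩ : ∃ B : Matrix ι ι ℝ, A x = B.conjTranspose * B :=
    CStarAlgebra.nonneg_iff_eq_star_mul_self.mp hA.nonneg
  have hsum : ellipticOp b A c f x
      = ∑ k, fderiv ℝ (fderiv ℝ f) x (∑ i, B k i • b i) (∑ i, B k i • b i) := by
    simp only [ellipticOp, hx.fderiv_eq_zero, fderiv_fderiv_apply hf, hB, Matrix.mul_apply,
      Matrix.conjTranspose_apply, star_trivial, map_sum, map_smul,
      sum_apply, smul_apply, smul_eq_mul,
      zero_apply, mul_zero, Finset.sum_const_zero, add_zero, Finset.sum_mul,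
      Finset.mul_sum]
    rw [Finset.sum_comm_cycle]
    refine Finset.sum_congr rfl fun k _ => ?_
    rw [Finset.sum_comm]
    refine Finset.sum_congr rfl fun i _ => Finset.sum_congr rfl fun l _ => ?_
    ring
  rw [hsum]
  exact Finset.sum_nonpos fun k _ => hx.fderiv_fderiv_nonpos hf _

theorem ellipticOp_add_const_mul {f w : V → ℝ} {x : V} (hf : ContDiffAt ℝ 2 f x)
    (hw : ContDiffAt ℝ 2 w x) (ε : ℝ) :
    ellipticOp b A c (fun y => f y + ε * w y) x
      = ellipticOp b A c f x + ε * ellipticOp b A c w x := by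
  have h1 : ∀ᶠ y in 𝓝 x, fderiv ℝ (fun y => f y + ε * w y) y
      = fderiv ℝ f y + ε • fderiv ℝ w y := by
    filter_upwards [hf.eventually (by simp), hw.eventually (by simp)] with y hfy hwy
    have hf' := hfy.differentiableAt (by norm_num)
    have hw' := hwy.differentiableAt (by norm_num)
    rw [fderiv_fun_add hf' (hw'.const_mul ε), fderiv_const_mul hw']
  have h2 : fderiv ℝ (fderiv ℝ (fun y => f y + ε * w y)) x
      = fderiv ℝ (fderiv ℝ f) x + ε • fderiv ℝ (fderiv ℝ w) x := by
    rw [Filter.EventuallyEq.fderiv_eq h1]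
    have hf' : DifferentiableAt ℝ (fderiv ℝ f) x :=
      (hf.fderiv_right (m := 1) (by norm_num)).differentiableAt (by norm_num)
    have hw' : DifferentiableAt ℝ (fderiv ℝ w) x :=
      (hw.fderiv_right (m := 1) (by norm_num)).differentiableAt (by norm_num)
    rw [fderiv_fun_add hf' (hw'.fun_const_smul ε), fderiv_fun_const_smul hw']
  have hs : ContDiffAt ℝ 2 (fun y => f y + ε * w y) x := hf.add (contDiffAt_const.mul hw)
  simp only [ellipticOp, fderiv_fderiv_apply hf, fderiv_fderiv_apply hw, fderiv_fderiv_apply hs,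
    h2, h1.self_of_nhds, add_apply, smul_apply,
    smul_eq_mul, mul_add, Finset.sum_add_distrib, Finset.mul_sum]
  simp only [mul_left_comm]
  ring

theorem continuousAt_ellipticOp {w : V → ℝ} {x : V} (hA : ∀ i l, ContinuousAt (fun y => A y i l) x)
    (hc : ∀ l, ContinuousAt (fun y => c y l) x) (hw : ContDiff ℝ 2 w) :
    ContinuousAt (ellipticOp b A c w) x := by
  have h1 : Continuous (fderiv ℝ w) := hw.continuous_fderiv (by norm_num)
  have h2 : Continuous (fderiv ℝ (fderiv ℝ w)) :=
    (hw.fderiv_right (m := 1) (by norm_num)).continuous_fderiv (by norm_num)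
  have h : ellipticOp b A c w = fun y => ∑ i, ∑ l, A y i l * fderiv ℝ (fderiv ℝ w) y (b i) (b l)
      + ∑ l, c y l * fderiv ℝ w y (b l) := by
    ext y; simp only [ellipticOp, fderiv_fderiv_apply hw.contDiffAt]
  rw [h]
  have h3 (i l : ι) : ContinuousAt (fun y => fderiv ℝ (fderiv ℝ w) y (b i) (b l)) x := by
    exact (Continuous.clm_apply (h2.clm_apply continuous_const) continuous_const).continuousAt
  have h4 (l : ι) : ContinuousAt (fun y => fderiv ℝ w y (b l)) x :=
    (h1.clm_apply continuous_const).continuousAt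
  refine ContinuousAt.add ?_ ?_
  · exact tendsto_finsetSum _ fun i _ => tendsto_finsetSum _ fun l _ => (hA i l).mul (h3 i l)
  · exact tendsto_finsetSum _ fun l _ => (hc l).mul (h4 l)

/-- Adding a large multiple of its square to a function with nonvanishing gradient at a zero makes
an elliptic operator positive at that zero. -/
theorem exists_ellipticOp_add_sq_pos {u : V → ℝ} {z : V} (hu : ContDiff ℝ 2 u) (hz : u z = 0)
    (hdu : fderiv ℝ u z ≠ 0) (hA : (A z).PosDef) :
    ∃ k : ℝ, 0 < ellipticOp b A c (fun y => u y + k * u y ^ 2) z := by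
  have hu2 : ContDiff ℝ 2 (fun y => u y ^ 2) := hu.pow 2
  have hud : Differentiable ℝ u := hu.differentiable (by norm_num)
  have hfd : DifferentiableAt ℝ (fderiv ℝ u) z :=
    (hu.fderiv_right (m := 1) (by norm_num)).differentiable (by norm_num) z
  have h1 : fderiv ℝ (fun y => u y ^ 2) = fun y => (2 * u y) • fderiv ℝ u y := by
    ext y v
    rw [fderiv_fun_pow 2 (hud y)]; simp
  have h2 (v w : V) : fderiv ℝ (fderiv ℝ (fun y => u y ^ 2)) z v w
      = 2 * fderiv ℝ u z v * fderiv ℝ u z w := by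
    rw [h1, fderiv_fun_smul ((hud z).const_mul 2) hfd, fderiv_const_mul (hud z)]
    simp [hz]
  have hpos : 0 < ellipticOp b A c (fun y => u y ^ 2) z := by
    have hξ : (fun i => fderiv ℝ u z (b i)) ≠ 0 := by
      intro h
      apply hdu
      have : (fderiv ℝ u z : V →ₗ[ℝ] ℝ) = 0 := b.ext fun i => congrFun h i
      ext v; exact LinearMap.congr_fun this v
    have h3 := hA.dotProduct_mulVec_pos hξ
    -- Since `u z = 0`, only the product of first derivatives survives: this is twice the form `A z`
    -- at the gradient of `u`.
    have h4 : ellipticOp b A c (fun y => u y ^ 2) z = 2 * (star (fun i => fderiv ℝ u z (b i)) ⬝ᵥ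
        (A z).mulVec (fun i => fderiv ℝ u z (b i))) := by
      simp only [ellipticOp, fderiv_fderiv_apply hu2.contDiffAt, h2]
      simp only [h1, hz, dotProduct, Matrix.mulVec, Pi.star_apply, star_trivial, mul_zero, zero_smul,
        zero_apply, Finset.sum_const_zero, add_zero, Finset.mul_sum]
      exact Finset.sum_congr rfl fun i _ => Finset.sum_congr rfl fun l _ => by ring
    rw [h4]; linarith
  -- This `k` makes the value at `z` equal to `1`.
  refine ⟨(1 - ellipticOp b A c u z) / ellipticOp b A c (fun y => u y ^ 2) z, ?_⟩
  rw [ellipticOp_add_const_mul hu.contDiffAt hu2.contDiffAt, div_mul_cancel₀ _ hpos.ne']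
  linarith

/-- **Touching lemma**: a subsolution with a maximum at `z` cannot be strictly below this maximum
on `{0 ≤ u} \ {z}` when `u` is a function which vanishes at `z` with nonzero gradient. -/
theorem false_of_ellipticOp_nonneg_of_touching [FiniteDimensional ℝ V] {f u : V → ℝ} {z : V}
    {U : Set V} (hU : U ∈ 𝓝 z)
    (hA : ∀ i l, ContinuousAt (fun y => A y i l) z) (hc : ∀ l, ContinuousAt (fun y => c y l) z)
    (hpd : ∀ y ∈ U, (A y).PosDef) (hf : ∀ y ∈ U, ContDiffAt ℝ 2 f y)
    (hL : ∀ y ∈ U, 0 ≤ ellipticOp b A c f y) (hmax : ∀ y ∈ U, f y ≤ f z)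
    (hu : ContDiff ℝ 2 u) (hz : u z = 0) (hdu : fderiv ℝ u z ≠ 0)
    (htouch : ∀ y ∈ U, 0 ≤ u y → y ≠ z → f y < f z) : False := by
  obtain ⟨k, hk⟩ := exists_ellipticOp_add_sq_pos (b := b) (c := c) hu hz hdu
    (hpd z (mem_of_mem_nhds hU))
  -- The barrier: near `z` the operator is positive on `w`, and `w = u (1 + k u)` has the sign of
  -- `u`.
  set w : V → ℝ := fun y => u y + k * u y ^ 2 with hw
  have hwC : ContDiff ℝ 2 w := hu.add (contDiff_const.mul (hu.pow 2))
  have hwz : w z = 0 := by simp [hw, hz]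
  have e1 : ∀ᶠ y in 𝓝 z, 0 < ellipticOp b A c w y :=
    (continuousAt_ellipticOp hA hc hwC).eventually (lt_mem_nhds hk)
  have e2 : ∀ᶠ y in 𝓝 z, 0 < 1 + k * u y := by
    have : ContinuousAt (fun y => 1 + k * u y) z :=
      (continuous_const.add (continuous_const.mul hu.continuous)).continuousAt
    exact this.eventually (lt_mem_nhds (by simp [hz]))
  obtain ⟨δ, hδ, hball⟩ := Metric.nhds_basis_closedBall.mem_iff.mp
    (Filter.inter_mem hU (Filter.inter_mem e1 e2))
  have hcU : ∀ y ∈ Metric.closedBall z δ, y ∈ U := fun y hy => (hball hy).1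
  have hfc : ContinuousOn f (Metric.closedBall z δ) := fun y hy =>
    (hf y (hcU y hy)).continuousAt.continuousWithinAt
  have hSsub : Metric.sphere z δ ∩ {y | 0 ≤ w y} ⊆ Metric.closedBall z δ :=
    fun y hy => Metric.sphere_subset_closedBall hy.1
  have hS : IsCompact (Metric.sphere z δ ∩ {y | 0 ≤ w y}) :=
    (isCompact_sphere z δ).inter_right (isClosed_le continuous_const hwC.continuous)
  have hSlt : ∀ y ∈ Metric.sphere z δ ∩ {y | 0 ≤ w y}, f y < f z := by
    intro y hy
    have hy' := hball (hSsub hy)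
    refine htouch y hy'.1 ?_ ?_
    · have h1 : w y = u y * (1 + k * u y) := by simp only [hw]; ring
      have h2 : 0 ≤ u y * (1 + k * u y) := h1 ▸ hy.2
      exact nonneg_of_mul_nonneg_left h2 hy'.2.2
    · rintro rfl
      have := hy.1
      simp at this
      exact hδ.ne this
  -- On the part of the sphere with `w ≥ 0`, compactness leaves a gap below `f z`, which a small `ε`
  -- respects; where `w < 0`, any positive `ε` works.
  obtain ⟨ε, hε, hεlt⟩ : ∃ ε : ℝ, 0 < ε ∧ ∀ y ∈ Metric.sphere z δ, f y + ε * w y < f z := by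
    have key : ∃ ε : ℝ, 0 < ε ∧ ∀ y ∈ Metric.sphere z δ ∩ {y | 0 ≤ w y}, f y + ε * w y < f z := by
      rcases (Metric.sphere z δ ∩ {y | 0 ≤ w y}).eq_empty_or_nonempty with he | hne
      · exact ⟨1, one_pos, by simp [he]⟩
      obtain ⟨y₁, hy₁, h₁⟩ := hS.exists_isMaxOn hne (hfc.mono hSsub)
      obtain ⟨y₂, hy₂, h₂⟩ := hS.exists_isMaxOn hne hwC.continuous.continuousOn
      have hη : 0 < f z - f y₁ := sub_pos.mpr (hSlt y₁ hy₁)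
      have hw2 : 0 ≤ w y₂ := hy₂.2
      -- The `+ 1` covers the case `w y₂ = 0` and makes the bound strict.
      refine ⟨(f z - f y₁) / (w y₂ + 1), by positivity, fun y hy => ?_⟩
      have h3 : f y ≤ f y₁ := h₁ hy
      have h4 : w y ≤ w y₂ := h₂ hy
      have h5 : (f z - f y₁) / (w y₂ + 1) * w y < f z - f y₁ := by
        rw [div_mul_eq_mul_div, div_lt_iff₀ (by positivity)]
        exact mul_lt_mul_of_pos_left (by linarith) hη
      linarith
    obtain ⟨ε, hε, h⟩ := key
    refine ⟨ε, hε, fun y hy => ?_⟩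
    rcases le_or_gt 0 (w y) with h0 | h0
    · exact h y ⟨hy, h0⟩
    · have h1 := hmax y (hcU y (Metric.sphere_subset_closedBall hy))
      have h2 := mul_neg_of_pos_of_neg hε h0
      linarith
  -- The maximum of `f + ε w` over the ball is at least its value `f z` at the centre, so it is
  -- interior. There the operator is positive on `f + ε w`, against
  -- `ellipticOp_nonpos_of_isLocalMax`.
  obtain ⟨y, hy, hymax⟩ := (isCompact_closedBall z δ).exists_isMaxOn
    ⟨z, Metric.mem_closedBall_self hδ.le⟩
    (hfc.add (continuousOn_const.mul hwC.continuous.continuousOn) :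
      ContinuousOn (fun y => f y + ε * w y) _)
  have hyz : f z ≤ f y + ε * w y := by
    have : f z + ε * w z ≤ f y + ε * w y := hymax (Metric.mem_closedBall_self hδ.le)
    simpa [hwz] using this
  have hyb : y ∈ Metric.ball z δ := by
    rcases (Metric.mem_closedBall.mp hy).lt_or_eq with h | h
    · exact h
    · exact absurd hyz (not_le.mpr (hεlt y h))
  have hyl : IsLocalMax (fun y => f y + ε * w y) y :=
    hymax.isLocalMax (Filter.mem_of_superset (Metric.isOpen_ball.mem_nhds hyb)
      Metric.ball_subset_closedBall)
  have hyU := hball hy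
  have h1 := ellipticOp_nonpos_of_isLocalMax (b := b) (c := c) (hpd y hyU.1).posSemidef
    ((hf y hyU.1).add (contDiffAt_const.mul hwC.contDiffAt)) hyl
  rw [ellipticOp_add_const_mul (hf y hyU.1) hwC.contDiffAt] at h1
  have h2 := hL y hyU.1
  have h3 := mul_pos hε hyU.2.1
  linarith

end MaximumPrinciple

/-! ### Hopf's strong maximum principle. -/

section StrongMaximumPrinciple

variable {V : Type*} [NormedAddCommGroup V] [InnerProductSpace ℝ V] [FiniteDimensional ℝ V]
  {ι : Type*} [Fintype ι] {b : Module.Basis ι ℝ V} {A : V → Matrix ι ι ℝ} {c : V → ι → ℝ}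

/-- **Strong maximum principle** of Hopf. -/
theorem eventually_eq_of_ellipticOp_nonneg {f : V → ℝ} {x₀ : V} {U : Set V} (hU : IsOpen U)
    (hx₀ : x₀ ∈ U) (hA : ∀ i l, ContinuousOn (fun y => A y i l) U)
    (hc : ∀ l, ContinuousOn (fun y => c y l) U) (hpd : ∀ y ∈ U, (A y).PosDef)
    (hf : ContDiffOn ℝ 2 f U) (hL : ∀ y ∈ U, 0 ≤ ellipticOp b A c f y)
    (hmax : ∀ y ∈ U, f y ≤ f x₀) : ∀ᶠ y in 𝓝 x₀, f y = f x₀ := by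
  obtain ⟨R, hR, hball⟩ := Metric.nhds_basis_closedBall.mem_iff.mp (hU.mem_nhds hx₀)
  have hfc : ContinuousOn f (Metric.closedBall x₀ R) := hf.continuousOn.mono hball
  by_contra hne
  -- Radius `R / 2` ensures that the point `z` of `Z` nearest to `y` lies in the open ball: `dist z
  -- x₀ ≤ 2 * dist y x₀ < R`.
  obtain ⟨y, hyR, hyne⟩ : ∃ y ∈ Metric.ball x₀ (R / 2), f y ≠ f x₀ := by
    by_contra! h
    exact hne (Filter.eventually_of_mem (Metric.ball_mem_nhds x₀ (half_pos hR)) h)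
  set Z : Set V := Metric.closedBall x₀ R ∩ f ⁻¹' {f x₀} with hZ
  have hZc : IsCompact Z :=
    (isCompact_closedBall x₀ R).of_isClosed_subset
      (hfc.preimage_isClosed_of_isClosed Metric.isClosed_closedBall isClosed_singleton)
      Set.inter_subset_left
  have hx₀Z : x₀ ∈ Z := ⟨Metric.mem_closedBall_self hR.le, rfl⟩
  obtain ⟨z, hzZ, hzmin⟩ := hZc.exists_isMinOn ⟨x₀, hx₀Z⟩
    (continuous_id.dist continuous_const : Continuous fun x => dist x y).continuousOn
  have hzx : dist z y ≤ dist x₀ y := hzmin hx₀Z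
  have hyR' : dist y x₀ < R / 2 := hyR
  have hzR : z ∈ Metric.ball x₀ R := by
    have := dist_triangle z y x₀
    rw [dist_comm x₀ y] at hzx
    exact Metric.mem_ball.mpr (by linarith)
  have hzy : z - y ≠ 0 := by
    intro h
    rw [sub_eq_zero] at h
    exact hyne (h ▸ hzZ.2)
  have hfz : f z = f x₀ := hzZ.2
  have hballU : Metric.ball x₀ R ⊆ U := Metric.ball_subset_closedBall.trans hball
  have hUz : Metric.ball x₀ R ∈ 𝓝 z := Metric.isOpen_ball.mem_nhds hzR
  have hnU : U ∈ 𝓝 z := hU.mem_nhds (hballU hzR)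
  have hd (a : V) : HasFDerivAt (fun x => ‖x - a‖ ^ 2) (2 • (innerSL ℝ (z - a))) z := by
    simpa using ((hasFDerivAt_id z).sub_const a).norm_sq
  -- By Thales, `{0 ≤ u}` is the closed ball with diameter from `y` to `z`. Apart from `z` it lies
  -- strictly inside the ball about `y` through `z`, which contains no point of `Z`.
  refine false_of_ellipticOp_nonneg_of_touching (b := b) (A := A) (c := c) (f := f)
    (u := fun x => ‖z - y‖ ^ 2 - ‖x - y‖ ^ 2 - ‖x - z‖ ^ 2) hUz
    (fun i l => (hA i l).continuousAt hnU) (fun l => (hc l).continuousAt hnU)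
    (fun x hx => hpd x (hballU hx)) (fun x hx => hf.contDiffAt (hU.mem_nhds (hballU hx)))
    (fun x hx => hL x (hballU hx)) (fun x hx => hfz ▸ hmax x (hballU hx)) ?_ (by simp) ?_ ?_
  · exact (contDiff_const.sub ((contDiff_id.sub contDiff_const).norm_sq ℝ)).sub
      ((contDiff_id.sub contDiff_const).norm_sq ℝ)
  · have h := (((hd y).const_sub (‖z - y‖ ^ 2)).fun_sub (hd z)).fderiv
    intro h0
    rw [h] at h0
    have h1 := DFunLike.congr_fun h0 (z - y)
    simp only [sub_self, map_zero, smul_zero, sub_zero, neg_apply,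
      smul_apply, innerSL_apply_apply, real_inner_self_eq_norm_sq,
      zero_apply, neg_eq_zero, nsmul_eq_mul, mul_eq_zero,
      pow_eq_zero_iff, norm_eq_zero, ne_eq, OfNat.ofNat_ne_zero, not_false_eq_true] at h1
    rcases h1 with h1 | h1
    · norm_num at h1
    · exact hzy h1
  · intro x hx hux hxz
    have h1 : 0 < ‖x - z‖ ^ 2 := by
      have := norm_pos_iff.mpr (sub_ne_zero.mpr hxz); positivity
    have h2 : ‖x - y‖ < ‖z - y‖ := by
      refine lt_of_pow_lt_pow_left₀ 2 (norm_nonneg _) ?_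
      linarith
    refine lt_of_le_of_ne (hfz ▸ hmax x (hballU hx)) fun hfx => ?_
    have hxZ : x ∈ Z := ⟨Metric.ball_subset_closedBall hx, by simp [hfx, hfz]⟩
    have h3 : dist z y ≤ dist x y := hzmin hxZ
    rw [dist_eq_norm, dist_eq_norm] at h3
    linarith

end StrongMaximumPrinciple

/-! ### Ricci curvature of a static metric in coordinates. -/

section RicciStatic

variable {V : Type*} [NormedAddCommGroup V] [NormedSpace ℝ V]
  {ι : Type*} [Fintype ι] [DecidableEq ι]

theorem contDiffOn_det {n : ℕ∞ω} {h : V → Matrix ι ι ℝ} {U : Set V}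
    (hh : ∀ i j, ContDiffOn ℝ n (fun y => h y i j) U) : ContDiffOn ℝ n (fun y => (h y).det) U := by
  simp only [Matrix.det_apply']
  exact ContDiffOn.sum fun σ _ => contDiffOn_const.mul (contDiffOn_prod fun i _ => hh _ _)

/-- By Cramer's rule the entries of the inverse are quotients of determinants. -/
theorem contDiffOn_inv_apply {n : ℕ∞ω} {h : V → Matrix ι ι ℝ} {U : Set V}
    (hh : ∀ i j, ContDiffOn ℝ n (fun y => h y i j) U) (hdet : ∀ y ∈ U, (h y).det ≠ 0) (i j : ι) :
    ContDiffOn ℝ n (fun y => (h y)⁻¹ i j) U := by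
  have h1 (y : V) : (h y)⁻¹ i j = (h y).det⁻¹ * ((h y).updateRow j (Pi.single i 1)).det := by
    rw [Matrix.inv_def, Matrix.smul_apply, Matrix.adjugate_apply, Ring.inverse_eq_inv', smul_eq_mul]
  simp only [h1]
  refine ((contDiffOn_det hh).inv hdet).mul (contDiffOn_det fun k l => ?_)
  by_cases hk : k = j
  · subst hk; simpa using contDiffOn_const
  · simpa [Matrix.updateRow_ne hk] using hh k l

theorem fderiv_of_eventuallyEq_comp_snd {F : ℝ × V → ℝ} {H : V → ℝ} {t : ℝ} {y : V}
    (hF : ∀ᶠ z in 𝓝 (t, y), F z = H z.2) (hH : DifferentiableAt ℝ H y) (v : ℝ × V) :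
    fderiv ℝ F (t, y) v = fderiv ℝ H y v.2 := by
  have h2 : F =ᶠ[𝓝 (t, y)] H ∘ Prod.snd := hF
  rw [h2.fderiv_eq]
  have : DifferentiableAt ℝ H (t, y).2 := hH
  rw [fderiv_comp (t, y) this differentiableAt_snd, fderiv_snd]
  rfl

/-- The matrix of the metric `-u² dt² ⊕ h`. -/
def staticMatrix (u : V → ℝ) (h : V → Matrix ι ι ℝ) (y : V) : Matrix (Unit ⊕ ι) (Unit ⊕ ι) ℝ :=
  Matrix.fromBlocks (Matrix.of fun _ _ => -(u y) ^ 2) 0 0 (h y)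

omit [NormedAddCommGroup V] [NormedSpace ℝ V] in
theorem staticMatrix_inv {u : V → ℝ} {h : V → Matrix ι ι ℝ} {y : V} (hu : u y ≠ 0)
    (hh : (h y).det ≠ 0) : (staticMatrix u h y)⁻¹
      = Matrix.fromBlocks (Matrix.of fun _ _ => -((u y) ^ 2)⁻¹) 0 0 (h y)⁻¹ := by
  apply Matrix.inv_eq_left_inv
  have h1 : (Matrix.of fun _ _ => -((u y) ^ 2)⁻¹ : Matrix Unit Unit ℝ)
      * (Matrix.of fun _ _ => -(u y) ^ 2) = 1 := by
    ext i j; simp [Matrix.mul_apply, hu]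
  rw [staticMatrix, Matrix.fromBlocks_multiply, Matrix.nonsing_inv_mul _ (isUnit_iff_ne_zero.mpr hh)]
  simp [h1]

variable {b : Module.Basis ι ℝ V} {G : ℝ × V → Matrix (Unit ⊕ ι) (Unit ⊕ ι) ℝ} {T : Set ℝ}
  {U : Set V} {u : V → ℝ} {h : V → Matrix ι ι ℝ}

/-- The gradient of `u² / 2` with respect to the metric `h`, in components. -/
def halfSqGrad (b : Module.Basis ι ℝ V) (u : V → ℝ) (h : V → Matrix ι ι ℝ) (k : ι) (y : V) : ℝ :=
  ∑ l, (h y)⁻¹ k l * (u y * fderiv ℝ u y (b l))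

/-- The metric with components `G` is `-u² dt² ⊕ h` on the open set `T × U`. -/
structure IsStaticOn (G : ℝ × V → Matrix (Unit ⊕ ι) (Unit ⊕ ι) ℝ) (T : Set ℝ) (U : Set V)
    (u : V → ℝ) (h : V → Matrix ι ι ℝ) : Prop where
  isOpen_left : IsOpen T
  isOpen_right : IsOpen U
  eq : ∀ t ∈ T, ∀ y ∈ U, G (t, y) = staticMatrix u h y
  pos : ∀ y ∈ U, 0 < u y
  posDef : ∀ y ∈ U, (h y).PosDef
  contDiffOn_lapse : ContDiffOn ℝ ∞ u U
  contDiffOn_metric : ∀ i j, ContDiffOn ℝ ∞ (fun y => h y i j) U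

namespace IsStaticOn

variable (S : IsStaticOn G T U u h) {t : ℝ} {y : V} (ht : t ∈ T) (hy : y ∈ U)
include S

theorem det_ne_zero (hy : y ∈ U) : (h y).det ≠ 0 := (S.posDef y hy).det_pos.ne'

theorem contDiffOn_inv (i j : ι) : ContDiffOn ℝ ∞ (fun y => (h y)⁻¹ i j) U :=
  contDiffOn_inv_apply S.contDiffOn_metric (fun _ hy => S.det_ne_zero hy) i j

omit [Fintype ι] [DecidableEq ι] in
theorem contDiffOn_fderiv {f : V → ℝ} (hf : ContDiffOn ℝ ∞ f U) (v : V) :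
    ContDiffOn ℝ ∞ (fun y => fderiv ℝ f y v) U :=
  (hf.fderiv_of_isOpen S.isOpen_right (by simp)).clm_apply contDiffOn_const

theorem contDiffOn_halfSqGrad (k : ι) : ContDiffOn ℝ ∞ (halfSqGrad b u h k) U :=
  ContDiffOn.sum fun l _ => (S.contDiffOn_inv k l).mul
    (S.contDiffOn_lapse.mul (S.contDiffOn_fderiv S.contDiffOn_lapse _))

theorem contDiffOn_christoffel (k i j : ι) : ContDiffOn ℝ ∞ (christoffel b h k i j) U :=
  contDiffOn_const.mul <| ContDiffOn.sum fun l _ => (S.contDiffOn_inv k l).mul <|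
    ((S.contDiffOn_fderiv (S.contDiffOn_metric _ _) _).add
      (S.contDiffOn_fderiv (S.contDiffOn_metric _ _) _)).sub
      (S.contDiffOn_fderiv (S.contDiffOn_metric _ _) _)

omit [Fintype ι] [DecidableEq ι] in
theorem differentiableAt (hy : y ∈ U) {f : V → ℝ} (hf : ContDiffOn ℝ ∞ f U) :
    DifferentiableAt ℝ f y :=
  (hf.contDiffAt (S.isOpen_right.mem_nhds hy)).differentiableAt (by simp)

include ht hy

omit [Fintype ι] [DecidableEq ι] in
theorem eventually {P : ℝ × V → Prop} (hP : ∀ t ∈ T, ∀ y ∈ U, P (t, y)) :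
    ∀ᶠ z in 𝓝 (t, y), P z := by
  filter_upwards [(S.isOpen_left.prod S.isOpen_right).mem_nhds ⟨ht, hy⟩] with z hz
  exact hP z.1 hz.1 z.2 hz.2

theorem inv_eq : (G (t, y))⁻¹
    = Matrix.fromBlocks (Matrix.of fun _ _ => -((u y) ^ 2)⁻¹) 0 0 (h y)⁻¹ := by
  rw [S.eq t ht y hy, staticMatrix_inv (S.pos y hy).ne' (S.det_ne_zero hy)]

omit [Fintype ι] [DecidableEq ι] in
theorem fderiv_inl_inl (v : ℝ × V) : fderiv ℝ (fun z => G z (.inl ()) (.inl ())) (t, y) v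
    = -(2 * u y * fderiv ℝ u y v.2) := by
  have hd := S.differentiableAt hy S.contDiffOn_lapse
  rw [fderiv_of_eventuallyEq_comp_snd (H := fun y => -(u y) ^ 2)
    (S.eventually ht hy fun t ht y hy => by simp [S.eq t ht y hy, staticMatrix]) (hd.pow 2).neg,
    fderiv_fun_neg, fderiv_fun_pow 2 hd]
  simp

omit [Fintype ι] [DecidableEq ι] in
theorem fderiv_inl_inr (i : ι) (v : ℝ × V) :
    fderiv ℝ (fun z => G z (.inl ()) (.inr i)) (t, y) v = 0 := by
  rw [fderiv_of_eventuallyEq_comp_snd (H := fun y => 0)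
    (S.eventually ht hy fun t ht y hy => by simp [S.eq t ht y hy, staticMatrix])
    (differentiableAt_const 0)]
  simp

omit [Fintype ι] [DecidableEq ι] in
theorem fderiv_inr_inl (i : ι) (v : ℝ × V) :
    fderiv ℝ (fun z => G z (.inr i) (.inl ())) (t, y) v = 0 := by
  rw [fderiv_of_eventuallyEq_comp_snd (H := fun y => 0)
    (S.eventually ht hy fun t ht y hy => by simp [S.eq t ht y hy, staticMatrix])
    (differentiableAt_const 0)]
  simp

omit [Fintype ι] [DecidableEq ι] in
theorem fderiv_inr_inr (i j : ι) (v : ℝ × V) :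
    fderiv ℝ (fun z => G z (.inr i) (.inr j)) (t, y) v = fderiv ℝ (fun y => h y i j) y v.2 :=
  fderiv_of_eventuallyEq_comp_snd
    (S.eventually ht hy fun t ht y hy => by simp [S.eq t ht y hy, staticMatrix])
    (S.differentiableAt hy (S.contDiffOn_metric i j)) v

/-- The inverse metric is block diagonal and nothing depends on time, so only the spatial derivative
of `g_tt = -u²` contributes. -/
theorem christoffel_inr_inl_inl (k : ι) :
    christoffel ((Module.Basis.singleton Unit ℝ).prod b) G (.inr k) (.inl ()) (.inl ()) (t, y)
      = halfSqGrad b u h k y := by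
  simp only [christoffel, S.inv_eq ht hy, Fintype.sum_sum_type, S.fderiv_inl_inl ht hy,
    S.fderiv_inl_inr ht hy]
  simp [halfSqGrad, Finset.mul_sum]
  exact Finset.sum_congr rfl fun l _ => by ring

theorem christoffel_inl_inr_inl (i : ι) :
    christoffel ((Module.Basis.singleton Unit ℝ).prod b) G (.inl ()) (.inr i) (.inl ()) (t, y)
      = fderiv ℝ u y (b i) / u y := by
  have := (S.pos y hy).ne'
  simp only [christoffel, S.inv_eq ht hy, Fintype.sum_sum_type, S.fderiv_inl_inl ht hy,
    S.fderiv_inl_inr ht hy, S.fderiv_inr_inl ht hy]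
  simp
  field_simp

theorem christoffel_inl_inl_inl :
    christoffel ((Module.Basis.singleton Unit ℝ).prod b) G (.inl ()) (.inl ()) (.inl ()) (t, y)
      = 0 := by
  simp only [christoffel, S.inv_eq ht hy, Fintype.sum_sum_type, S.fderiv_inl_inl ht hy]
  simp

theorem christoffel_inr_inr_inl (k i : ι) :
    christoffel ((Module.Basis.singleton Unit ℝ).prod b) G (.inr k) (.inr i) (.inl ()) (t, y)
      = 0 := by
  simp only [christoffel, S.inv_eq ht hy, Fintype.sum_sum_type, S.fderiv_inl_inr ht hy,
    S.fderiv_inr_inl ht hy, S.fderiv_inr_inr ht hy]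
  simp

theorem christoffel_inr_inl_inr (k i : ι) :
    christoffel ((Module.Basis.singleton Unit ℝ).prod b) G (.inr k) (.inl ()) (.inr i) (t, y)
      = 0 := by
  simp only [christoffel, S.inv_eq ht hy, Fintype.sum_sum_type, S.fderiv_inl_inr ht hy,
    S.fderiv_inr_inl ht hy, S.fderiv_inr_inr ht hy]
  simp

theorem christoffel_inr_inr_inr (k i j : ι) :
    christoffel ((Module.Basis.singleton Unit ℝ).prod b) G (.inr k) (.inr i) (.inr j) (t, y)
      = christoffel b h k i j y := by
  simp only [christoffel, S.inv_eq ht hy, Fintype.sum_sum_type, S.fderiv_inr_inr ht hy]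
  simp

/-- The first and third sums form the divergence of `∇(u² / 2)` and the second is `|∇u|²`, so the
total is `u Δu`. The symbols `Γ^t_{tk}` need not be computed: they occur only in two products that
cancel. -/
theorem ricciCoord_inl_inl :
    ricciCoord ((Module.Basis.singleton Unit ℝ).prod b) G (t, y) (.inl ()) (.inl ())
      = ∑ i, fderiv ℝ (halfSqGrad b u h i) y (b i)
        - ∑ i, halfSqGrad b u h i y * (fderiv ℝ u y (b i) / u y)
        + ∑ i, ∑ l, christoffel b h i i l y * halfSqGrad b u h l y := by
  have h1 (i : ι) (v : ℝ × V) : fderiv ℝ (christoffel ((Module.Basis.singleton Unit ℝ).prod b) G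
      (.inr i) (.inl ()) (.inl ())) (t, y) v = fderiv ℝ (halfSqGrad b u h i) y v.2 :=
    fderiv_of_eventuallyEq_comp_snd
      (S.eventually ht hy fun t ht y hy => S.christoffel_inr_inl_inl ht hy i)
      (S.differentiableAt hy (S.contDiffOn_halfSqGrad i)) v
  have h2 (i : ι) (v : ℝ × V) : fderiv ℝ (christoffel ((Module.Basis.singleton Unit ℝ).prod b) G
      (.inr i) (.inr i) (.inl ())) (t, y) v = 0 := by
    rw [fderiv_of_eventuallyEq_comp_snd (H := fun _ => 0)
      (S.eventually ht hy fun t ht y hy => S.christoffel_inr_inr_inl ht hy i i)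
      (differentiableAt_const 0)]
    simp
  simp only [ricciCoord, Fintype.sum_sum_type, h1, h2, S.christoffel_inr_inl_inl ht hy,
    S.christoffel_inl_inl_inl ht hy, S.christoffel_inl_inr_inl ht hy,
    S.christoffel_inr_inr_inl ht hy, S.christoffel_inr_inl_inr ht hy,
    S.christoffel_inr_inr_inr ht hy, Finset.sum_add_distrib]
  simp
  ring

omit ht hy in
/-- The time component of the Ricci tensor of a static metric is an elliptic operator in the lapse
function. -/
theorem exists_ricciCoord_eq_ellipticOp : ∃ c : V → ι → ℝ,
    (∀ l, ContinuousOn (fun y => c y l) U) ∧ ∀ t ∈ T, ∀ y ∈ U,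
      ricciCoord ((Module.Basis.singleton Unit ℝ).prod b) G (t, y) (.inl ()) (.inl ())
        = ellipticOp b (fun y => u y • (h y)⁻¹) c u y := by
  -- These are the factors of `∂_m u` after the product rule. They involve `u` and its gradient, the
  -- quadratic gradient term being read as a coefficient times `∂_m u`; this is harmless, as the
  -- maximum principle asks only for continuity.
  refine ⟨fun y m => ∑ i, fderiv ℝ (fun z => (h z)⁻¹ i m * u z) y (b i)
    - ∑ i, (h y)⁻¹ i m * fderiv ℝ u y (b i)
    + ∑ i, ∑ l, christoffel b h i i l y * ((h y)⁻¹ l m * u y), fun m => ?_, fun t ht y hy => ?_⟩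
  · refine ContDiffOn.continuousOn (𝕜 := ℝ) (n := ∞) ?_
    refine ((ContDiffOn.sum fun i _ => ?_).sub (ContDiffOn.sum fun i _ => ?_)).add
      (ContDiffOn.sum fun i _ => ContDiffOn.sum fun l _ => ?_)
    · exact S.contDiffOn_fderiv ((S.contDiffOn_inv i m).mul S.contDiffOn_lapse) _
    · exact (S.contDiffOn_inv i m).mul (S.contDiffOn_fderiv S.contDiffOn_lapse _)
    · exact (S.contDiffOn_christoffel i i l).mul ((S.contDiffOn_inv l m).mul S.contDiffOn_lapse)
  · rw [S.ricciCoord_inl_inl ht hy]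
    have hX (i : ι) : fderiv ℝ (halfSqGrad b u h i) y (b i)
        = ∑ m, (fderiv ℝ (fun z => (h z)⁻¹ i m * u z) y (b i) * fderiv ℝ u y (b m)
          + u y * (h y)⁻¹ i m * fderiv ℝ (fun z => fderiv ℝ u z (b m)) y (b i)) := by
      have h1 : halfSqGrad b u h i
          = fun z => ∑ m, ((h z)⁻¹ i m * u z) * fderiv ℝ u z (b m) := by
        ext z; simp only [halfSqGrad, mul_assoc]
      have h2 (m : ι) := S.differentiableAt hy ((S.contDiffOn_inv i m).mul S.contDiffOn_lapse)
      have h3 (m : ι) := S.differentiableAt hy (S.contDiffOn_fderiv S.contDiffOn_lapse (b m))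
      rw [h1, fderiv_fun_sum fun m _ => (h2 m).fun_mul (h3 m), sum_apply]
      refine Finset.sum_congr rfl fun m _ => ?_
      rw [fderiv_fun_mul (h2 m) (h3 m)]
      simp
      ring
    have hu := (S.pos y hy).ne'
    have e1 : ∑ i, halfSqGrad b u h i y * (fderiv ℝ u y (b i) / u y)
        = ∑ m, (∑ i, (h y)⁻¹ i m * fderiv ℝ u y (b i)) * fderiv ℝ u y (b m) := by
      simp only [halfSqGrad, Finset.sum_mul]
      rw [Finset.sum_comm]
      refine Finset.sum_congr rfl fun i _ => Finset.sum_congr rfl fun m _ => ?_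
      field_simp
    have e2 : ∑ i, ∑ l, christoffel b h i i l y * halfSqGrad b u h l y
        = ∑ m, (∑ i, ∑ l, christoffel b h i i l y * ((h y)⁻¹ l m * u y)) * fderiv ℝ u y (b m) := by
      simp only [halfSqGrad, Finset.sum_mul, Finset.mul_sum]
      rw [Finset.sum_comm_cycle]
      refine Finset.sum_congr rfl fun m _ => Finset.sum_congr rfl fun i _ =>
        Finset.sum_congr rfl fun l _ => ?_
      ring
    rw [e1, e2]
    simp only [hX, ellipticOp, Finset.sum_add_distrib, add_mul, sub_mul, Finset.sum_sub_distrib,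
      Finset.sum_mul, Matrix.smul_apply, smul_eq_mul]
    rw [Finset.sum_comm (f := fun i m => fderiv ℝ (fun z => (h z)⁻¹ i m * u z) y (b i)
      * fderiv ℝ u y (b m))]
    ring

end IsStaticOn

end RicciStatic

/-- The quadratic form of the matrix at `ξ` is `β (D v) (D v)` for `v = ∑ ξ i • b i`, and `D v ≠ 0`
when `ξ ≠ 0`. -/
theorem posDef_gram {ι V W : Type*} [Fintype ι] [NormedAddCommGroup V] [NormedSpace ℝ V]
    [AddCommGroup W] [Module ℝ W] [TopologicalSpace W] [IsTopologicalAddGroup W]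
    [ContinuousSMul ℝ W] (b : Module.Basis ι ℝ V) (β : W →L[ℝ] W →L[ℝ] ℝ)
    (hsymm : ∀ v w, β v w = β w v) (hpos : ∀ v, v ≠ 0 → 0 < β v v) (D : V →L[ℝ] W)
    (hD : Function.Injective D) :
    (Matrix.of fun i j => β (D (b i)) (D (b j))).PosDef := by
  refine Matrix.PosDef.of_dotProduct_mulVec_pos ?_ fun ξ hξ => ?_
  · ext i j
    exact hsymm _ _
  · have hv0 : ∑ i, ξ i • b i ≠ 0 := fun h0 =>
      hξ (funext fun i => Fintype.linearIndependent_iff.mp b.linearIndependent ξ h0 i)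
    refine (hpos _ ((map_ne_zero_iff D hD).mpr hv0)).trans_eq ?_
    simp only [map_sum, map_smul, sum_apply, smul_apply, smul_eq_mul, dotProduct, Matrix.mulVec,
      Finset.mul_sum, Matrix.of_apply, Pi.star_apply, star_trivial]
    rw [Finset.sum_comm]
    exact Finset.sum_congr rfl fun i _ => Finset.sum_congr rfl fun j _ => by ring

/-! ### The fibre metric in a chart: positivity and smoothness. -/

section RiemannianChart

variable {s : ℕ} {F : Type*} [TopologicalSpace F]
  [ChartedSpace (EuclideanSpace ℝ (Fin s)) F] [IsManifold (𝓡 s) ∞ F]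
  (gF : Bundle.ContMDiffRiemannianMetric (𝓡 s) ∞ (EuclideanSpace ℝ (Fin s))
      (fun x : F => TangentSpace (𝓡 s) x))

theorem mdifferentiableAt_extChartAt_symm {x₀ : F} {y : EuclideanSpace ℝ (Fin s)}
    (hy : y ∈ (extChartAt (𝓡 s) x₀).target) :
    MDifferentiableAt 𝓘(ℝ, EuclideanSpace ℝ (Fin s)) (𝓡 s) (extChartAt (𝓡 s) x₀).symm y :=
  ((contMDiffOn_extChartAt_symm (n := ∞) x₀).contMDiffAt
    ((isOpen_extChartAt_target x₀).mem_nhds hy)).mdifferentiableAt (by simp)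

theorem mfderiv_extChartAt_symm_injective {x₀ : F} {y : EuclideanSpace ℝ (Fin s)}
    (hy : y ∈ (extChartAt (𝓡 s) x₀).target) : Function.Injective
      (mfderiv 𝓘(ℝ, EuclideanSpace ℝ (Fin s)) (𝓡 s) (extChartAt (𝓡 s) x₀).symm y) := by
  have : IsManifold (𝓡 s) 1 F := .of_le (n := ∞) (by simp)
  have h := mfderiv_extChartAt_comp_mfderivWithin_extChartAt_symm hy
  rw [ModelWithCorners.Boundaryless.range_eq_univ, mfderivWithin_univ] at h
  intro v w hvw
  have hv := DFunLike.congr_fun h v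
  have hw := DFunLike.congr_fun h w
  simp only [ContinuousLinearMap.comp_apply, hvw] at hv hw
  exact hv.symm.trans hw

theorem posDef_metricInChart (x₀ : F) {y : EuclideanSpace ℝ (Fin s)}
    (hy : y ∈ (extChartAt (𝓡 s) x₀).target) :
    (metricInChart (EuclideanSpace.basisFun (Fin s) ℝ).toBasis (𝓡 s) gF.inner
      (chartAt (EuclideanSpace ℝ (Fin s)) x₀) y).PosDef := by
  exact posDef_gram (EuclideanSpace.basisFun (Fin s) ℝ).toBasis
    (gF.inner ((extChartAt (𝓡 s) x₀).symm y)) (gF.symm _) (gF.pos _)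
    (mfderiv 𝓘(ℝ, EuclideanSpace ℝ (Fin s)) (𝓡 s) (extChartAt (𝓡 s) x₀).symm y)
    (mfderiv_extChartAt_symm_injective hy)

/-- Coordinate vector fields are the tangent map of the inverse chart applied to constant fields,
hence smooth; the smooth tensor `gF` is evaluated on two of them. -/
theorem contDiffOn_metricInChart (x₀ : F) (i j : Fin s) : ContDiffOn ℝ ∞ (fun y =>
    metricInChart (EuclideanSpace.basisFun (Fin s) ℝ).toBasis (𝓡 s) gF.inner
      (chartAt (EuclideanSpace ℝ (Fin s)) x₀) y i j) (extChartAt (𝓡 s) x₀).target := by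
  have : IsManifold (𝓡 s) 1 F := .of_le (n := ∞) (by simp)
  have hU := isOpen_extChartAt_target (I := 𝓡 s) x₀
  have hsymm := contMDiffOn_extChartAt_symm (I := 𝓡 s) (n := ∞) x₀
  have hvec (v : EuclideanSpace ℝ (Fin s)) : ContMDiffOn 𝓘(ℝ, EuclideanSpace ℝ (Fin s))
      ((𝓡 s).prod 𝓘(ℝ, EuclideanSpace ℝ (Fin s))) ∞
      (fun y => (⟨(extChartAt (𝓡 s) x₀).symm y, mfderiv 𝓘(ℝ, EuclideanSpace ℝ (Fin s)) (𝓡 s)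
        (extChartAt (𝓡 s) x₀).symm y v⟩ : TangentBundle (𝓡 s) F))
      (extChartAt (𝓡 s) x₀).target := by
    have h1 := hsymm.contMDiffOn_tangentMapWithin (m := ∞) (by simp) hU.uniqueMDiffOn
    have h2 : ContMDiffOn 𝓘(ℝ, EuclideanSpace ℝ (Fin s)) (𝓘(ℝ, EuclideanSpace ℝ (Fin s)).tangent) ∞
        (fun y => (⟨y, v⟩ : TangentBundle 𝓘(ℝ, EuclideanSpace ℝ (Fin s))
          (EuclideanSpace ℝ (Fin s)))) (extChartAt (𝓡 s) x₀).target :=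
      contMDiffOn_vectorSpace_iff_contDiffOn.mpr contDiffOn_const
    refine (h1.comp h2 fun y hy => hy).congr fun y hy => ?_
    simp only [Function.comp_apply, tangentMapWithin, mfderivWithin_of_isOpen hU hy]
  rw [← contMDiffOn_iff_contDiffOn]
  intro y hy
  have h := ContMDiffWithinAt.clm_bundle_apply₂ (F₁ := EuclideanSpace ℝ (Fin s))
    (F₂ := EuclideanSpace ℝ (Fin s)) (E₁ := fun x : F => TangentSpace (𝓡 s) x)
    (E₂ := fun x : F => TangentSpace (𝓡 s) x) (F₃ := ℝ) (E₃ := Bundle.Trivial F ℝ)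
    ((gF.contMDiff.contMDiffAt.comp_contMDiffWithinAt y (hsymm y hy)))
    (hvec ((EuclideanSpace.basisFun (Fin s) ℝ).toBasis i) y hy)
    (hvec ((EuclideanSpace.basisFun (Fin s) ℝ).toBasis j) y hy)
  rw [Bundle.contMDiffWithinAt_totalSpace] at h
  exact h.2

end RiemannianChart

/-! ### The static metric in product charts. -/

section StaticChart

variable {s : ℕ} {F : Type*} [TopologicalSpace F]
  [ChartedSpace (EuclideanSpace ℝ (Fin s)) F] [IsManifold (𝓡 s) ∞ F]
  {t₁ t₂ : EReal}

theorem coe_extChartAt_openInterval_symm (q : openInterval t₁ t₂) {t : ℝ}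
    (ht : t ∈ (extChartAt 𝓘(ℝ, ℝ) q).target) :
    (((extChartAt 𝓘(ℝ, ℝ) q).symm t : openInterval t₁ t₂) : ℝ) = t := by
  -- The chart of an open subset of `ℝ` is the inclusion.
  have h (x : openInterval t₁ t₂) : extChartAt 𝓘(ℝ, ℝ) q x = (x : ℝ) := rfl
  rw [← h]
  exact (extChartAt 𝓘(ℝ, ℝ) q).right_inv ht

omit [IsManifold (𝓡 s) ∞ F] in
theorem mdifferentiable_time : MDifferentiable (𝓘(ℝ, ℝ).prod (𝓡 s)) 𝓘(ℝ, ℝ)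
    (fun q : openInterval t₁ t₂ × F => ((q.1 : openInterval t₁ t₂) : ℝ)) :=
  ((contMDiff_subtype_val (I := 𝓘(ℝ, ℝ)) (n := 1)).comp contMDiff_fst).mdifferentiable (by simp)

theorem mdifferentiableAt_extChartAt_prod_symm (p : openInterval t₁ t₂ × F)
    {z : ℝ × EuclideanSpace ℝ (Fin s)} (hz : z ∈ (extChartAt (𝓘(ℝ, ℝ).prod (𝓡 s)) p).target) :
    MDifferentiableAt 𝓘(ℝ, ℝ × EuclideanSpace ℝ (Fin s)) (𝓘(ℝ, ℝ).prod (𝓡 s))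
      (extChartAt (𝓘(ℝ, ℝ).prod (𝓡 s)) p).symm z :=
  ((contMDiffOn_extChartAt_symm (n := ∞) p).contMDiffAt
    ((isOpen_extChartAt_target p).mem_nhds hz)).mdifferentiableAt (by simp)

theorem mfderiv_time_mfderiv_symm (p : openInterval t₁ t₂ × F)
    {z : ℝ × EuclideanSpace ℝ (Fin s)} (hz : z ∈ (extChartAt (𝓘(ℝ, ℝ).prod (𝓡 s)) p).target)
    (v : ℝ × EuclideanSpace ℝ (Fin s)) :
    mfderiv (𝓘(ℝ, ℝ).prod (𝓡 s)) 𝓘(ℝ, ℝ)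
      (fun q : openInterval t₁ t₂ × F => ((q.1 : openInterval t₁ t₂) : ℝ))
      ((extChartAt (𝓘(ℝ, ℝ).prod (𝓡 s)) p).symm z)
      (mfderiv 𝓘(ℝ, ℝ × EuclideanSpace ℝ (Fin s)) (𝓘(ℝ, ℝ).prod (𝓡 s))
        (extChartAt (𝓘(ℝ, ℝ).prod (𝓡 s)) p).symm z v) = v.1 := by
  have h := mfderiv_comp z (mdifferentiable_time _) (mdifferentiableAt_extChartAt_prod_symm p hz)
  have he : (fun q : openInterval t₁ t₂ × F => ((q.1 : openInterval t₁ t₂) : ℝ))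
      ∘ (extChartAt (𝓘(ℝ, ℝ).prod (𝓡 s)) p).symm =ᶠ[𝓝 z] Prod.fst := by
    filter_upwards [(isOpen_extChartAt_target p).mem_nhds hz] with w hw
    rw [extChartAt_prod] at hw ⊢
    exact coe_extChartAt_openInterval_symm p.1 hw.1
  rw [he.mfderiv_eq, mfderiv_eq_fderiv] at h
  have h2 := DFunLike.congr_fun h v
  rw [fderiv_fst] at h2
  exact h2.symm

theorem mfderiv_snd_mfderiv_symm (p : openInterval t₁ t₂ × F)
    {z : ℝ × EuclideanSpace ℝ (Fin s)} (hz : z ∈ (extChartAt (𝓘(ℝ, ℝ).prod (𝓡 s)) p).target)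
    (v : ℝ × EuclideanSpace ℝ (Fin s)) :
    mfderiv (𝓘(ℝ, ℝ).prod (𝓡 s)) (𝓡 s) (Prod.snd : openInterval t₁ t₂ × F → F)
      ((extChartAt (𝓘(ℝ, ℝ).prod (𝓡 s)) p).symm z)
      (mfderiv 𝓘(ℝ, ℝ × EuclideanSpace ℝ (Fin s)) (𝓘(ℝ, ℝ).prod (𝓡 s))
        (extChartAt (𝓘(ℝ, ℝ).prod (𝓡 s)) p).symm z v)
      = mfderiv 𝓘(ℝ, EuclideanSpace ℝ (Fin s)) (𝓡 s) (extChartAt (𝓡 s) p.2).symm z.2 v.2 := by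
  have hz2 : z.2 ∈ (extChartAt (𝓡 s) p.2).target := by
    rw [extChartAt_prod] at hz; exact hz.2
  have h := mfderiv_comp z (mdifferentiableAt_snd (M := openInterval t₁ t₂) (M' := F))
    (mdifferentiableAt_extChartAt_prod_symm p hz)
  have he : Prod.snd ∘ (extChartAt (𝓘(ℝ, ℝ).prod (𝓡 s)) p).symm
      = (extChartAt (𝓡 s) p.2).symm ∘ Prod.snd := by
    rw [extChartAt_prod]; rfl
  have h' := mfderiv_comp (I := 𝓘(ℝ, ℝ × EuclideanSpace ℝ (Fin s)))
    (I' := 𝓘(ℝ, EuclideanSpace ℝ (Fin s))) z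
    (mdifferentiableAt_extChartAt_symm hz2) (f := Prod.snd)
    (DifferentiableAt.mdifferentiableAt differentiableAt_snd)
  rw [he, h', mfderiv_eq_fderiv, fderiv_snd] at h
  exact (DFunLike.congr_fun h v).symm

variable (gF : Bundle.ContMDiffRiemannianMetric (𝓡 s) ∞ (EuclideanSpace ℝ (Fin s))
      (fun x : F => TangentSpace (𝓡 s) x)) (f : F → ℝ)

/-- The differential of the time function of a static space-time. -/
def timeForm (p : openInterval t₁ t₂ × F) : TangentSpace (𝓘(ℝ, ℝ).prod (𝓡 s)) p →L[ℝ] ℝ :=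
  mfderiv (𝓘(ℝ, ℝ).prod (𝓡 s)) 𝓘(ℝ, ℝ)
    (fun q : openInterval t₁ t₂ × F => ((q.1 : openInterval t₁ t₂) : ℝ)) p

/-- The differential of the projection of a static space-time to its fibre. -/
def fibreMap (p : openInterval t₁ t₂ × F) :
    TangentSpace (𝓘(ℝ, ℝ).prod (𝓡 s)) p →L[ℝ] TangentSpace (𝓡 s) p.2 :=
  mfderiv (𝓘(ℝ, ℝ).prod (𝓡 s)) (𝓡 s) (Prod.snd : openInterval t₁ t₂ × F → F) p

theorem staticMetric_apply (p : openInterval t₁ t₂ × F)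
    (v w : TangentSpace (𝓘(ℝ, ℝ).prod (𝓡 s)) p) :
    staticMetric t₁ t₂ f gF p v w
      = gF.inner p.2 (fibreMap p v) (fibreMap p w) - f p.2 ^ 2 * (timeForm p v * timeForm p w) :=
  rfl

theorem metricInChart_staticMetric (p : openInterval t₁ t₂ × F)
    {z : ℝ × EuclideanSpace ℝ (Fin s)} (hz : z ∈ (extChartAt (𝓘(ℝ, ℝ).prod (𝓡 s)) p).target) :
    metricInChart (staticBasis s) (𝓘(ℝ, ℝ).prod (𝓡 s)) (staticMetric t₁ t₂ f gF) (chartAt _ p) z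
      = staticMatrix (f ∘ (extChartAt (𝓡 s) p.2).symm)
          (metricInChart (EuclideanSpace.basisFun (Fin s) ℝ).toBasis (𝓡 s) gF.inner
            (chartAt (EuclideanSpace ℝ (Fin s)) p.2)) z.2 := by
  have hsnd : ((extChartAt (𝓘(ℝ, ℝ).prod (𝓡 s)) p).symm z).2
      = (extChartAt (𝓡 s) p.2).symm z.2 := by
    rw [extChartAt_prod]; rfl
  have key (v w : ℝ × EuclideanSpace ℝ (Fin s)) :
      staticMetric t₁ t₂ f gF ((extChartAt (𝓘(ℝ, ℝ).prod (𝓡 s)) p).symm z)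
        (mfderiv 𝓘(ℝ, ℝ × EuclideanSpace ℝ (Fin s)) (𝓘(ℝ, ℝ).prod (𝓡 s))
          (extChartAt (𝓘(ℝ, ℝ).prod (𝓡 s)) p).symm z v)
        (mfderiv 𝓘(ℝ, ℝ × EuclideanSpace ℝ (Fin s)) (𝓘(ℝ, ℝ).prod (𝓡 s))
          (extChartAt (𝓘(ℝ, ℝ).prod (𝓡 s)) p).symm z w)
      = gF.inner ((extChartAt (𝓡 s) p.2).symm z.2)
          (mfderiv 𝓘(ℝ, EuclideanSpace ℝ (Fin s)) (𝓡 s) (extChartAt (𝓡 s) p.2).symm z.2 v.2)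
          (mfderiv 𝓘(ℝ, EuclideanSpace ℝ (Fin s)) (𝓡 s) (extChartAt (𝓡 s) p.2).symm z.2 w.2)
        - f ((extChartAt (𝓡 s) p.2).symm z.2) ^ 2 * (v.1 * w.1) := by
    rw [staticMetric_apply]
    have h1 (v : ℝ × EuclideanSpace ℝ (Fin s)) : timeForm _
      (mfderiv 𝓘(ℝ, ℝ × EuclideanSpace ℝ (Fin s)) (𝓘(ℝ, ℝ).prod (𝓡 s))
          (extChartAt (𝓘(ℝ, ℝ).prod (𝓡 s)) p).symm z v) = v.1 := mfderiv_time_mfderiv_symm p hz v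
    have h2 (v : ℝ × EuclideanSpace ℝ (Fin s)) : fibreMap _
      (mfderiv 𝓘(ℝ, ℝ × EuclideanSpace ℝ (Fin s)) (𝓘(ℝ, ℝ).prod (𝓡 s))
          (extChartAt (𝓘(ℝ, ℝ).prod (𝓡 s)) p).symm z v)
        = mfderiv 𝓘(ℝ, EuclideanSpace ℝ (Fin s)) (𝓡 s) (extChartAt (𝓡 s) p.2).symm z.2 v.2 :=
      mfderiv_snd_mfderiv_symm p hz v
    rw [h1, h1, h2, h2, hsnd]
  ext i j
  refine (key (staticBasis s i) (staticBasis s j)).trans ?_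
  -- Pulling `gF` back to a bilinear form on the model space lets the blocks be evaluated on basis
  -- vectors, with bilinearity killing the mixed ones.
  obtain ⟨β, hβ⟩ : ∃ β : EuclideanSpace ℝ (Fin s) →L[ℝ] EuclideanSpace ℝ (Fin s) →L[ℝ] ℝ,
      ∀ v w : EuclideanSpace ℝ (Fin s), β v w = gF.inner ((extChartAt (𝓡 s) p.2).symm z.2)
        (mfderiv 𝓘(ℝ, EuclideanSpace ℝ (Fin s)) (𝓡 s) (extChartAt (𝓡 s) p.2).symm z.2 v)
        (mfderiv 𝓘(ℝ, EuclideanSpace ℝ (Fin s)) (𝓡 s) (extChartAt (𝓡 s) p.2).symm z.2 w) :=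
    let D : EuclideanSpace ℝ (Fin s) →L[ℝ] TangentSpace (𝓡 s)
        ((extChartAt (𝓡 s) p.2).symm z.2) :=
      mfderiv 𝓘(ℝ, EuclideanSpace ℝ (Fin s)) (𝓡 s) (extChartAt (𝓡 s) p.2).symm z.2
    ⟨(ContinuousLinearMap.precomp ℝ D) ∘L (gF.inner _) ∘L D, fun _ _ => rfl⟩
  have hm (i j : Fin s) : metricInChart (EuclideanSpace.basisFun (Fin s) ℝ).toBasis (𝓡 s) gF.inner
      (chartAt (EuclideanSpace ℝ (Fin s)) p.2) z.2 i j
      = β ((EuclideanSpace.basisFun (Fin s) ℝ).toBasis i)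
        ((EuclideanSpace.basisFun (Fin s) ℝ).toBasis j) := (hβ _ _).symm
  refine (congrArg (· - _) (hβ _ _).symm).trans ?_
  rcases i with i | i <;> rcases j with j | j <;>
    simp [staticBasis, staticMatrix, hm]

end StaticChart

/-! ### Energy conditions and constancy of the lapse. -/

section StaticRicci

variable {s : ℕ} {F : Type*} [TopologicalSpace F]
  [ChartedSpace (EuclideanSpace ℝ (Fin s)) F] [IsManifold (𝓡 s) ∞ F]
  {t₁ t₂ : EReal} (gF : Bundle.ContMDiffRiemannianMetric (𝓡 s) ∞ (EuclideanSpace ℝ (Fin s))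
      (fun x : F => TangentSpace (𝓡 s) x)) {f : F → ℝ}

theorem isStaticOn_metricInChart (hf : ContMDiff (𝓡 s) 𝓘(ℝ, ℝ) ∞ f) (hpos : ∀ x, 0 < f x)
    (p : openInterval t₁ t₂ × F) :
    IsStaticOn (metricInChart (staticBasis s) (𝓘(ℝ, ℝ).prod (𝓡 s)) (staticMetric t₁ t₂ f gF)
        (chartAt _ p)) (extChartAt 𝓘(ℝ, ℝ) p.1).target (extChartAt (𝓡 s) p.2).target
      (f ∘ (extChartAt (𝓡 s) p.2).symm)
      (metricInChart (EuclideanSpace.basisFun (Fin s) ℝ).toBasis (𝓡 s) gF.inner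
        (chartAt (EuclideanSpace ℝ (Fin s)) p.2)) where
  isOpen_left := isOpen_extChartAt_target _
  isOpen_right := isOpen_extChartAt_target _
  eq t ht y hy := metricInChart_staticMetric gF f p (z := (t, y)) (by
    rw [extChartAt_prod]; exact ⟨ht, hy⟩)
  pos y _ := hpos _
  posDef y hy := posDef_metricInChart gF p.2 hy
  contDiffOn_lapse :=
    contMDiffOn_iff_contDiffOn.mp (hf.comp_contMDiffOn (contMDiffOn_extChartAt_symm p.2))
  contDiffOn_metric := contDiffOn_metricInChart gF p.2

/-- The vector is `∂_t`. The chart stays centred at `p` while the base point varies, because the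
maximum principle needs the inequality on an open set of one chart. -/
theorem exists_timeVector_of_mem_target (p : openInterval t₁ t₂ × F)
    {z : ℝ × EuclideanSpace ℝ (Fin s)} (hz : z ∈ (extChartAt (𝓘(ℝ, ℝ).prod (𝓡 s)) p).target) :
    ∃ v : TangentSpace (𝓘(ℝ, ℝ).prod (𝓡 s)) ((extChartAt (𝓘(ℝ, ℝ).prod (𝓡 s)) p).symm z),
      timeForm _ v = 1 ∧ fibreMap _ v = 0 ∧
      ∀ g : ∀ q : openInterval t₁ t₂ × F, TangentSpace (𝓘(ℝ, ℝ).prod (𝓡 s)) q →L[ℝ]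
          TangentSpace (𝓘(ℝ, ℝ).prod (𝓡 s)) q →L[ℝ] ℝ,
        ricci (staticBasis s) (𝓘(ℝ, ℝ).prod (𝓡 s)) g (chartAt _ p) _ v v
          = ricciCoord (staticBasis s) (metricInChart (staticBasis s) (𝓘(ℝ, ℝ).prod (𝓡 s)) g
            (chartAt _ p)) z (.inl ()) (.inl ()) := by
  have : IsManifold (𝓘(ℝ, ℝ).prod (𝓡 s)) 1 (openInterval t₁ t₂ × F) := .of_le (n := ∞) (by simp)
  refine ⟨mfderiv 𝓘(ℝ, ℝ × EuclideanSpace ℝ (Fin s)) (𝓘(ℝ, ℝ).prod (𝓡 s))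
    (extChartAt (𝓘(ℝ, ℝ).prod (𝓡 s)) p).symm z ((1, 0) : ℝ × EuclideanSpace ℝ (Fin s)),
    mfderiv_time_mfderiv_symm p hz _, (mfderiv_snd_mfderiv_symm p hz _).trans ?_, fun g => ?_⟩
  · exact ContinuousLinearMap.map_zero
      (mfderiv 𝓘(ℝ, EuclideanSpace ℝ (Fin s)) (𝓡 s) (extChartAt (𝓡 s) p.2).symm z.2)
  · have h := mfderiv_extChartAt_comp_mfderivWithin_extChartAt_symm hz
    rw [ModelWithCorners.Boundaryless.range_eq_univ, mfderivWithin_univ] at h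
    have hv := DFunLike.congr_fun h ((1, 0) : ℝ × EuclideanSpace ℝ (Fin s))
    have hz' : (chartAt (ModelProd ℝ (EuclideanSpace ℝ (Fin s))) p).extend
        (𝓘(ℝ, ℝ).prod (𝓡 s)) ((extChartAt (𝓘(ℝ, ℝ).prod (𝓡 s)) p).symm z) = z :=
      (extChartAt (𝓘(ℝ, ℝ).prod (𝓡 s)) p).right_inv hz
    have hr (k : Unit ⊕ Fin s) : (staticBasis s).repr
        ((1, 0) : ℝ × EuclideanSpace ℝ (Fin s)) k = if k = .inl () then 1 else 0 := by
      rcases k with k | k <;> simp [staticBasis]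
    have hk (k : Unit ⊕ Fin s) : (staticBasis s).repr
        (mfderiv (𝓘(ℝ, ℝ).prod (𝓡 s)) 𝓘(ℝ, ℝ × EuclideanSpace ℝ (Fin s))
          ((chartAt (ModelProd ℝ (EuclideanSpace ℝ (Fin s))) p).extend (𝓘(ℝ, ℝ).prod (𝓡 s)))
          ((extChartAt (𝓘(ℝ, ℝ).prod (𝓡 s)) p).symm z)
          (mfderiv 𝓘(ℝ, ℝ × EuclideanSpace ℝ (Fin s)) (𝓘(ℝ, ℝ).prod (𝓡 s))
            (extChartAt (𝓘(ℝ, ℝ).prod (𝓡 s)) p).symm z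
            ((1, 0) : ℝ × EuclideanSpace ℝ (Fin s)))) k = if k = .inl () then 1 else 0 :=
      (congrArg (fun w => (staticBasis s).repr w k) hv).trans (hr k)
    unfold ricci
    simp only [hk, hz', mul_ite, mul_one, mul_zero, Finset.sum_ite_eq', Finset.mem_univ, if_true]

theorem exists_timeVector (p : openInterval t₁ t₂ × F) :
    ∃ v : TangentSpace (𝓘(ℝ, ℝ).prod (𝓡 s)) p, timeForm p v = 1 ∧ fibreMap p v = 0 := by
  obtain ⟨v, h1, h2, -⟩ := exists_timeVector_of_mem_target p
    (mem_extChartAt_target (I := 𝓘(ℝ, ℝ).prod (𝓡 s)) p)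
  have h : ∃ v : TangentSpace (𝓘(ℝ, ℝ).prod (𝓡 s)) ((extChartAt (𝓘(ℝ, ℝ).prod (𝓡 s)) p).symm
    (extChartAt (𝓘(ℝ, ℝ).prod (𝓡 s)) p p)), timeForm _ v = 1 ∧ fibreMap _ v = 0 := ⟨v, h1, h2⟩
  rwa [extChartAt_to_inv] at h

/-- The condition is applied to `∂_t`, which is timelike because its square is `-f²`. -/
theorem TimelikeConvergenceCondition.ellipticOp_nonneg
    (h : TimelikeConvergenceCondition (staticBasis s) (𝓘(ℝ, ℝ).prod (𝓡 s))
      (staticMetric t₁ t₂ f gF)) (hf : ContMDiff (𝓡 s) 𝓘(ℝ, ℝ) ∞ f) (hpos : ∀ x, 0 < f x)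
    (p : openInterval t₁ t₂ × F) : ∃ c : EuclideanSpace ℝ (Fin s) → Fin s → ℝ,
      (∀ l, ContinuousOn (fun y => c y l) (extChartAt (𝓡 s) p.2).target) ∧
      ∀ y ∈ (extChartAt (𝓡 s) p.2).target,
        0 ≤ ellipticOp (EuclideanSpace.basisFun (Fin s) ℝ).toBasis
          (fun y => (f ∘ (extChartAt (𝓡 s) p.2).symm) y •
            (metricInChart (EuclideanSpace.basisFun (Fin s) ℝ).toBasis (𝓡 s) gF.inner
              (chartAt (EuclideanSpace ℝ (Fin s)) p.2) y)⁻¹) c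
          (f ∘ (extChartAt (𝓡 s) p.2).symm) y := by
  obtain ⟨c, hc, hR⟩ := (isStaticOn_metricInChart gF hf hpos p).exists_ricciCoord_eq_ellipticOp
    (b := (EuclideanSpace.basisFun (Fin s) ℝ).toBasis)
  refine ⟨c, hc, fun y hy => ?_⟩
  have hT := mem_extChartAt_target (I := 𝓘(ℝ, ℝ)) p.1
  rw [← hR _ hT y hy]
  have hz : (extChartAt 𝓘(ℝ, ℝ) p.1 p.1, y) ∈ (extChartAt (𝓘(ℝ, ℝ).prod (𝓡 s)) p).target := by
    rw [extChartAt_prod]; exact ⟨hT, hy⟩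
  obtain ⟨v, hv1, hv2, hv⟩ := exists_timeVector_of_mem_target p hz
  refine (h _ v ?_ (chartAt _ p) (IsManifold.chart_mem_maximalAtlas p) ?_).trans_eq (hv _)
  · rw [IsTimelike, staticMetric_apply, hv1, hv2, map_zero]
    have := hpos ((extChartAt (𝓘(ℝ, ℝ).prod (𝓡 s)) p).symm (extChartAt 𝓘(ℝ, ℝ) p.1 p.1, y)).2
    have := pow_pos this 2
    linarith
  · rw [← extChartAt_source (𝓘(ℝ, ℝ).prod (𝓡 s))]
    exact (extChartAt (𝓘(ℝ, ℝ).prod (𝓡 s)) p).map_target hz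

theorem strongEnergyCondition_iff_timelikeConvergenceCondition (hpos : ∀ x, 0 < f x) :
    StrongEnergyCondition (staticBasis s) (𝓘(ℝ, ℝ).prod (𝓡 s)) (staticMetric t₁ t₂ f gF) ↔
      TimelikeConvergenceCondition (staticBasis s) (𝓘(ℝ, ℝ).prod (𝓡 s))
        (staticMetric t₁ t₂ f gF) := by
  constructor
  · intro h p v hv e he hp
    refine h p v ⟨?_, hv.le⟩ e he hp
    rintro rfl
    rw [IsTimelike, map_zero] at hv
    exact lt_irrefl _ hv
  · intro h p v hv e he hp
    -- `T` is `∂_t` or `-∂_t`, with the sign for which adding `ε • T` enlarges the time component of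
    -- `v` in absolute value and leaves the fibre component unchanged.
    obtain ⟨T, hT1, hT2⟩ : ∃ T : TangentSpace (𝓘(ℝ, ℝ).prod (𝓡 s)) p,
        0 ≤ timeForm p v * timeForm p T ∧ timeForm p T ≠ 0 ∧ fibreMap p T = 0 := by
      obtain ⟨T, h1, h2⟩ := exists_timeVector (s := s) p
      rcases le_total 0 (timeForm p v) with h0 | h0
      · exact ⟨T, by simp [h1, h0], by simp [h1], h2⟩
      · exact ⟨-T, by simp [h1, h0], by simp [h1], by simp [h2]⟩
    obtain ⟨hT2, hT3⟩ := hT2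
    have htl (ε : ℝ) (hε : 0 < ε) : IsTimelike _ (staticMetric t₁ t₂ f gF) p (v + ε • T) := by
      have h1 := hv.2
      rw [IsTimelike]
      rw [staticMetric_apply] at h1 ⊢
      rw [map_add, map_smul, hT3, smul_zero, add_zero, map_add, map_smul, smul_eq_mul]
      have h2 : 0 < (timeForm p v + ε * timeForm p T) * (timeForm p v + ε * timeForm p T)
          - timeForm p v * timeForm p v := by
        have : 0 < (ε * timeForm p T) ^ 2 := by positivity
        have := mul_nonneg hε.le hT1
        linarith
      have h3 := mul_pos (pow_pos (hpos p.2) 2) h2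
      linarith
    have hcont : Continuous fun ε : ℝ => ricci (staticBasis s) (𝓘(ℝ, ℝ).prod (𝓡 s))
        (staticMetric t₁ t₂ f gF) e p (v + ε • T) (v + ε • T) := by
      have hL : Continuous fun ε : ℝ => mfderiv (𝓘(ℝ, ℝ).prod (𝓡 s))
          𝓘(ℝ, ℝ × EuclideanSpace ℝ (Fin s)) (e.extend (𝓘(ℝ, ℝ).prod (𝓡 s))) p (v + ε • T) :=
        (ContinuousLinearMap.continuous _).comp (by fun_prop)
      have hr (k : Unit ⊕ Fin s) : Continuous fun ε : ℝ => (staticBasis s).repr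
          (mfderiv (𝓘(ℝ, ℝ).prod (𝓡 s)) 𝓘(ℝ, ℝ × EuclideanSpace ℝ (Fin s))
            (e.extend (𝓘(ℝ, ℝ).prod (𝓡 s))) p (v + ε • T)) k :=
        ((staticBasis s).coord k).continuous_of_finiteDimensional.comp hL
      exact continuous_finsetSum _ fun j _ => continuous_finsetSum _ fun k _ =>
        (continuous_const.mul (hr j)).mul (hr k)
    have hlim := (hcont.tendsto 0).mono_left (nhdsWithin_le_nhds (s := Set.Ioi 0))
    rw [zero_smul, add_zero] at hlim
    refine ge_of_tendsto hlim ?_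
    filter_upwards [self_mem_nhdsWithin] with ε hε
    exact h p _ (htl ε hε) e he hp

theorem TimelikeConvergenceCondition.exists_eq_const [ConnectedSpace F] [CompactSpace F]
    (h : TimelikeConvergenceCondition (staticBasis s) (𝓘(ℝ, ℝ).prod (𝓡 s))
      (staticMetric t₁ t₂ f gF)) (hf : ContMDiff (𝓡 s) 𝓘(ℝ, ℝ) ∞ f) (hpos : ∀ x, 0 < f x)
    (t : openInterval t₁ t₂) : ∃ c : ℝ, 0 < c ∧ ∀ x : F, f x = c := by
  obtain ⟨x₀, -, hx₀⟩ := isCompact_univ.exists_isMaxOn Set.univ_nonempty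
    hf.continuous.continuousOn
  refine ⟨f x₀, hpos x₀, fun x => ?_⟩
  -- The strong maximum principle is applied in the chart centred at an arbitrary maximum point `a`;
  -- the result is then carried back to `F`.
  have hopen : IsOpen {x | f x = f x₀} := by
    rw [isOpen_iff_mem_nhds]
    intro a ha
    obtain ⟨c, hc, hL⟩ := h.ellipticOp_nonneg gF hf hpos (t, a)
    have S := isStaticOn_metricInChart gF hf hpos (t, a)
    have hfa : (f ∘ (extChartAt (𝓡 s) a).symm) (extChartAt (𝓡 s) a a) = f x₀ := by
      rw [Function.comp_apply, extChartAt_to_inv]; exact ha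
    have key := eventually_eq_of_ellipticOp_nonneg S.isOpen_right (mem_extChartAt_target a)
      (fun i l => S.contDiffOn_lapse.continuousOn.mul (S.contDiffOn_inv i l).continuousOn) hc
      (fun y hy => (S.posDef y hy).inv.smul (S.pos y hy))
      (S.contDiffOn_lapse.of_le ENat.LEInfty.out) hL
      (fun y _ => (hx₀ (Set.mem_univ _)).trans_eq hfa.symm)
    rw [hfa] at key
    filter_upwards [(continuousAt_extChartAt (I := 𝓡 s) a).eventually key,
      extChartAt_source_mem_nhds (I := 𝓡 s) a] with y hy hys
    rwa [Function.comp_apply, (extChartAt (𝓡 s) a).left_inv hys] at hy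
  have hclopen : IsClopen {x | f x = f x₀} :=
    ⟨isClosed_eq hf.continuous continuous_const, hopen⟩
  have huniv := hclopen.eq_univ ⟨x₀, rfl⟩
  exact Set.eq_univ_iff_forall.mp huniv x

end StaticRicci

end StaticSpacetime

end

theorem mainTheorem11 {s : ℕ} {F : Type*} [TopologicalSpace F] [T2Space F] [ConnectedSpace F]
    [CompactSpace F] [ChartedSpace (EuclideanSpace ℝ (Fin s)) F] [IsManifold (𝓡 s) ∞ F]
    (gF : Bundle.ContMDiffRiemannianMetric (𝓡 s) ∞ (EuclideanSpace ℝ (Fin s))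
      (fun x : F => TangentSpace (𝓡 s) x))
    (f : F → ℝ) (hf : ContMDiff (𝓡 s) 𝓘(ℝ, ℝ) ∞ f) (hpos : ∀ x, 0 < f x)
    (t₁ t₂ : EReal) (ht : t₁ < t₂) :
    (StaticSpacetime.StrongEnergyCondition (StaticSpacetime.staticBasis s)
          (𝓘(ℝ, ℝ).prod (𝓡 s)) (StaticSpacetime.staticMetric t₁ t₂ f gF) ↔
      StaticSpacetime.TimelikeConvergenceCondition (StaticSpacetime.staticBasis s)
          (𝓘(ℝ, ℝ).prod (𝓡 s)) (StaticSpacetime.staticMetric t₁ t₂ f gF)) ∧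
    (StaticSpacetime.StrongEnergyCondition (StaticSpacetime.staticBasis s)
          (𝓘(ℝ, ℝ).prod (𝓡 s)) (StaticSpacetime.staticMetric t₁ t₂ f gF) →
      ∃ c : ℝ, 0 < c ∧ ∀ x : F, f x = c) := by
  refine ⟨StaticSpacetime.strongEnergyCondition_iff_timelikeConvergenceCondition gF hpos,
    fun h => ?_⟩
  -- An instant is needed to have points of the space-time at all; over an empty interval the energy
  -- conditions would be vacuous.
  obtain ⟨t, ht₁, ht₂⟩ := EReal.lt_iff_exists_real_btwn.mp ht
  exact ((StaticSpacetime.strongEnergyCondition_iff_timelikeConvergenceCondition gF hpos).mp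
    h).exists_eq_const gF hf hpos ⟨t, ht₁, ht₂⟩
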